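/- Let $\mathbb{F}=\mathbb{F}_2$, and let $\mathscr{FA}$ be the category of functors from finite-dimensional $\mathbb{F}$-vector spaces to abelian groups. Write $V^\sharp=\mathrm{Hom}_{\mathbb{F}}(V,\mathbb{F})$, and let $D:\mathscr{FA}^{\mathrm{op}}\to\mathscr{FA}$ be the Pontrjagin duality functor $DF(V)=\mathrm{Hom}_{\mathrm{Ab}}(F(V^\sharp),\mathbb{Z}/2^\infty)$. Let $\overline{P}_{\mathbb{Z}}$ be the functor sending $V$ to the augmentation ideal of the group ring $\mathbb{Z}[V]$, let $\overline{P}_{\mathbb{Z}}^{k}\subset\overline{P}_{\mathbb{Z}}$ be the subfunctor given by the $k$-th powers of these ideals, let $\overline{P}_{\mathbb{Z}_2}=\mathbb{Z}_2\otimes\overline{P}_{\mathbb{Z}}$ with $\mathbb{Z}_2$ the $2$-adic integers, and for $n\in\mathbb{N}$ put $R^n_{\mathbb{Z}}=\overline{P}_{\mathbb{Z}}/\overline{P}_{\mathbb{Z}}^{n+1}$. This functor is annihilated by $2^n$, so there is a canonical surjection $\pi_n:\overline{P}_{\mathbb{Z}_2}\twoheadrightarrow R^n_{\mathbb{Z}}$,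 $z\otimes x\mapsto (z \bmod 2^n)\,[x]$. **Theorem.** Let $n>0$ be an integer. The functor $R^n_{\mathbb{Z}}$ is self-dual, that is, $R^n_{\mathbb{Z}}\cong DR^n_{\mathbb{Z}}$ in $\mathscr{FA}$. More precisely, there exist surjections $\overline{P}_{\mathbb{Z}_2}\twoheadrightarrow DR^n_{\mathbb{Z}}$ in $\mathscr{FA}$, and for every such surjection $f$ there is a unique isomorphism $e:R^n_{\mathbb{Z}}\xrightarrow{\ \cong\ }DR^n_{\mathbb{Z}}$ with $f=e\circ\pi_n$. -/

import Mathlib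

open CategoryTheory Opposite
open scoped TensorProduct

universe u

noncomputable section

namespace GroupRingFunctor

/-- The field `𝔽 = 𝔽₂`. -/
abbrev F2 : Type := ZMod 2

/-- The category of finite-dimensional `𝔽₂`-vector spaces. -/
abbrev Vf : Type (u + 1) := FGModuleCat.{u} F2

/-- The category of functors from finite-dimensional `𝔽₂`-vector spaces to abelian groups. -/
abbrev FA : Type (u + 1) := Vf.{u} ⥤ AddCommGrpCat.{u}

/-- A morphism of functors is a surjection if all of its components are surjective. -/
def IsSurjection {F G : FA.{u}} (f : F ⟶ G) : Prop :=
  ∀ V : Vf.{u}, Function.Surjective (f.app V)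

/-! ### Pontrjagin duality -/

/-- `ℤ/2^∞`: the subgroup of elements of `2`-power order in `ℚ/ℤ`. -/
def pruferSubgroup : AddSubgroup (AddCircle (1 : ℚ)) where
  carrier := {x | ∃ k : ℕ, (2 ^ k : ℕ) • x = 0}
  zero_mem' := ⟨0, by simp⟩
  add_mem' := by
    rintro x y ⟨k, hk⟩ ⟨l, hl⟩
    refine ⟨k + l, ?_⟩
    rw [smul_add, pow_add, mul_smul, mul_smul, hl, smul_zero, add_zero, smul_comm, hk, smul_zero]
  neg_mem' := by
    rintro x ⟨k, hk⟩
    exact ⟨k, by rw [smul_neg, hk, neg_zero]⟩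

/-- The group `ℤ/2^∞`. -/
abbrev Prufer2 : Type := pruferSubgroup

/-- Vector space duality `V ↦ V^♯`. -/
def vdual : Vf.{u}ᵒᵖ ⥤ Vf.{u} where
  obj V := FGModuleCat.of F2 (Module.Dual F2 V.unop)
  map g := FGModuleCat.ofHom (Module.Dual.transpose (R := F2) g.unop.hom.hom)
  map_id _ := rfl
  map_comp _ _ := rfl

/-- `A ↦ Hom(A, ℤ/2^∞)` on abelian groups. -/
def homPrufer : AddCommGrpCat.{u}ᵒᵖ ⥤ AddCommGrpCat.{u} where
  obj A := AddCommGrpCat.of (A.unop →+ Prufer2)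
  map g := AddCommGrpCat.ofHom (AddMonoidHom.compHom' g.unop.hom)
  map_id _ := rfl
  map_comp _ _ := rfl

/-- The Pontrjagin duality functor `D`, with `D F (V) = Hom(F(V^♯), ℤ/2^∞)`. -/
def D : FA.{u}ᵒᵖ ⥤ FA.{u} where
  obj F :=
    { obj := fun V => homPrufer.obj (op (F.unop.obj (vdual.obj (op V))))
      map := fun g => homPrufer.map (F.unop.map (vdual.map g.op)).op
      map_id := fun V => by
        rw [op_id, vdual.map_id, F.unop.map_id, op_id, homPrufer.map_id]
      map_comp := fun g h => by
        rw [op_comp, vdual.map_comp, F.unop.map_comp, op_comp, homPrufer.map_comp] }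
  map φ :=
    { app := fun V => homPrufer.map (φ.unop.app (vdual.obj (op V))).op
      naturality := fun V W g => by
        rw [← homPrufer.map_comp, ← homPrufer.map_comp, ← op_comp, ← op_comp,
          φ.unop.naturality] }
  map_id _ := rfl
  map_comp _ _ := rfl

/-! ### The group ring and the powers of its augmentation ideal -/

section Pointwise

variable (V : Type*) [AddCommGroup V]

/-- The augmentation `ℤ[V] → ℤ`, `[v] ↦ 1`. -/
def augmentation : AddMonoidAlgebra ℤ V →+* ℤ :=
  (AddMonoidAlgebra.lift ℤ ℤ V 1 : AddMonoidAlgebra ℤ V →ₐ[ℤ] ℤ).toRingHom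

/-- The augmentation ideal of `ℤ[V]`. -/
def augIdeal : Ideal (AddMonoidAlgebra ℤ V) := RingHom.ker (augmentation V)

/-- The `n`-th power of the augmentation ideal, as a subgroup of the augmentation ideal
(for `0 < n`: the subgroup generated by all products of `n` elements of the ideal). -/
def augPow (n : ℕ) : AddSubgroup (augIdeal V) :=
  (Submodule.comap (augIdeal V).subtype (augIdeal V ^ n)).toAddSubgroup

variable {V}

theorem augmentation_single (v : V) (a : ℤ) :
    augmentation V (AddMonoidAlgebra.single v a) = a := by
  simp [augmentation, AddMonoidAlgebra.lift_single]

theorem mem_augPow {n : ℕ} {x : augIdeal V} :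
    x ∈ augPow V n ↔ (x : AddMonoidAlgebra ℤ V) ∈ augIdeal V ^ n := Iff.rfl

variable {W : Type*} [AddCommGroup W]

theorem augmentation_map (g : V →+ W) (x : AddMonoidAlgebra ℤ V) :
    augmentation W (AddMonoidAlgebra.mapDomainRingHom ℤ g x) = augmentation V x := by
  induction x using AddMonoidAlgebra.induction_linear with
  | zero => simp
  | add x y hx hy => rw [map_add, map_add, map_add, hx, hy]
  | single v a => simp [augmentation_single]

/-- The map induced by `g : V → W` on augmentation ideals. -/
def augMap (g : V →+ W) : augIdeal V →+ augIdeal W where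
  toFun x := ⟨AddMonoidAlgebra.mapDomainRingHom ℤ g x, by
    have hx : augmentation V x = 0 := x.2
    change augmentation W _ = 0
    rw [augmentation_map, hx]⟩
  map_zero' := Subtype.ext (map_zero _)
  map_add' x y := Subtype.ext (map_add _ _ _)

theorem augMap_mem (g : V →+ W) (n : ℕ) : augPow V n ≤ (augPow W n).comap (augMap g) := by
  intro x hx
  have h1 : (augIdeal V).map (AddMonoidAlgebra.mapDomainRingHom ℤ g) ≤ augIdeal W :=
    Ideal.map_le_iff_le_comap.2 fun y hy => (augMap g ⟨y, hy⟩).2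
  have h2 := Ideal.mem_map_of_mem (AddMonoidAlgebra.mapDomainRingHom ℤ g) (mem_augPow.1 hx)
  rw [Ideal.map_pow] at h2
  exact Ideal.pow_right_mono h1 n h2

theorem augMap_id : augMap (AddMonoidHom.id V) = AddMonoidHom.id _ := by
  ext x : 2
  change AddMonoidAlgebra.mapDomainRingHom ℤ (AddMonoidHom.id V) (x : AddMonoidAlgebra ℤ V) = x
  rw [AddMonoidAlgebra.mapDomainRingHom_id, RingHom.id_apply]

theorem augMap_comp {U : Type*} [AddCommGroup U] (h : W →+ U) (g : V →+ W) :
    augMap (h.comp g) = (augMap h).comp (augMap g) := by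
  ext x : 2
  change AddMonoidAlgebra.mapDomainRingHom ℤ (h.comp g) (x : AddMonoidAlgebra ℤ V) = _
  rw [AddMonoidAlgebra.mapDomainRingHom_comp]
  rfl

/-- The map induced by `g : V → W` on the quotients `I/I^{n+1}` of the augmentation ideals. -/
def quotMap (n : ℕ) (g : V →+ W) :
    augIdeal V ⧸ augPow V (n + 1) →+ augIdeal W ⧸ augPow W (n + 1) :=
  QuotientAddGroup.map _ _ (augMap g) (augMap_mem g (n + 1))

theorem quotMap_id (n : ℕ) : quotMap n (AddMonoidHom.id V) = AddMonoidHom.id _ := by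
  ext x : 2
  exact congrArg (fun φ => (QuotientAddGroup.mk (φ x) : augIdeal V ⧸ augPow V (n + 1)))
    (augMap_id (V := V))

theorem quotMap_comp {U : Type*} [AddCommGroup U] (n : ℕ) (h : W →+ U) (g : V →+ W) :
    quotMap n (h.comp g) = (quotMap n h).comp (quotMap n g) := by
  ext x : 2
  exact congrArg (fun φ => (QuotientAddGroup.mk (φ x) : augIdeal U ⧸ augPow U (n + 1)))
    (augMap_comp h g)

/-- The map induced by `g : V → W` on `ℤ₂ ⊗ I`, with `I` the augmentation ideal. -/
def tensorMap (g : V →+ W) : ℤ_[2] ⊗[ℤ] augIdeal V →+ ℤ_[2] ⊗[ℤ] augIdeal W :=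
  (LinearMap.lTensor ℤ_[2] (augMap g).toIntLinearMap).toAddMonoidHom

theorem tensorMap_id : tensorMap (AddMonoidHom.id V) = AddMonoidHom.id _ := by
  have h : (augMap (AddMonoidHom.id V)).toIntLinearMap = LinearMap.id :=
    LinearMap.ext fun x => congrArg (fun φ => φ x) (augMap_id (V := V))
  rw [tensorMap, h, LinearMap.lTensor_id]
  rfl

theorem tensorMap_comp {U : Type*} [AddCommGroup U] (h : W →+ U) (g : V →+ W) :
    tensorMap (h.comp g) = (tensorMap h).comp (tensorMap g) := by
  have e : (augMap (h.comp g)).toIntLinearMap =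
      (augMap h).toIntLinearMap ∘ₗ (augMap g).toIntLinearMap :=
    LinearMap.ext fun x => congrArg (fun φ => φ x) (augMap_comp h g)
  rw [tensorMap, e, LinearMap.lTensor_comp]
  rfl

end Pointwise

/-- The underlying additive map of a morphism of vector spaces. -/
abbrev addHom {V W : Vf.{u}} (g : V ⟶ W) : V →+ W := g.hom.hom.toAddMonoidHom

/-- The functor `P̄_ℤ`, sending `V` to the augmentation ideal of `ℤ[V]`. -/
def Pbar : FA.{u} where
  obj V := AddCommGrpCat.of (augIdeal V)
  map g := AddCommGrpCat.ofHom (augMap (addHom g))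
  map_id V := congrArg AddCommGrpCat.ofHom (augMap_id (V := V))
  map_comp g h := congrArg AddCommGrpCat.ofHom (augMap_comp (addHom h) (addHom g))

/-- The functor `R^n_ℤ = P̄_ℤ / P̄_ℤ^{n+1}`. -/
def R (n : ℕ) : FA.{u} where
  obj V := AddCommGrpCat.of (augIdeal V ⧸ augPow V (n + 1))
  map g := AddCommGrpCat.ofHom (quotMap n (addHom g))
  map_id V := congrArg AddCommGrpCat.ofHom (quotMap_id (V := V) n)
  map_comp g h := congrArg AddCommGrpCat.ofHom (quotMap_comp n (addHom h) (addHom g))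

/-- The canonical projection `P̄_ℤ → R^n_ℤ`. -/
def proj (n : ℕ) : Pbar.{u} ⟶ R n where
  app V := AddCommGrpCat.ofHom (QuotientAddGroup.mk' (augPow V (n + 1)))
  naturality _ _ _ := rfl

/-- The functor `P̄_{ℤ₂} = ℤ₂ ⊗ P̄_ℤ`, where `ℤ₂` is the ring of `2`-adic integers. -/
def PbarZ2 : FA.{u} where
  obj V := AddCommGrpCat.of (ℤ_[2] ⊗[ℤ] augIdeal V)
  map g := AddCommGrpCat.ofHom (tensorMap (addHom g))
  map_id V := congrArg AddCommGrpCat.ofHom (tensorMap_id (V := V))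
  map_comp g h := congrArg AddCommGrpCat.ofHom (tensorMap_comp (addHom h) (addHom g))

/-- The canonical map `P̄_ℤ → P̄_{ℤ₂}`, `x ↦ 1 ⊗ x`. -/
def incl : Pbar.{u} ⟶ PbarZ2 where
  app V := AddCommGrpCat.ofHom (TensorProduct.mk ℤ ℤ_[2] (augIdeal V) 1).toAddMonoidHom
  naturality _ _ _ := rfl

/-! ### The canonical surjection from `P̄_{ℤ₂}` onto `R^n_ℤ` -/

section Canonical

variable {V : Type*} [AddCommGroup V]

theorem two_mul_sub_mem (hV : ∀ v : V, v + v = 0) (x : AddMonoidAlgebra ℤ V) :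
    2 * (x - (augmentation V x : AddMonoidAlgebra ℤ V)) ∈ augIdeal V ^ 2 := by
  induction x using AddMonoidAlgebra.induction_linear with
  | zero => simp
  | add x y hx hy =>
    have h := add_mem hx hy
    rw [map_add, Int.cast_add]
    convert h using 1
    ring
  | single v a =>
    have hs : (AddMonoidAlgebra.single v 1 : AddMonoidAlgebra ℤ V) ^ 2 = 1 := by
      rw [AddMonoidAlgebra.single_pow, one_pow, two_nsmul, hV, AddMonoidAlgebra.one_def]
    have ha : (AddMonoidAlgebra.single v a : AddMonoidAlgebra ℤ V) =
        (a : AddMonoidAlgebra ℤ V) * AddMonoidAlgebra.single v 1 := by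
      rw [← zsmul_eq_mul, AddMonoidAlgebra.smul_single, smul_eq_mul, mul_one]
    have hm : (AddMonoidAlgebra.single v 1 : AddMonoidAlgebra ℤ V) - 1 ∈ augIdeal V := by
      change augmentation V _ = 0
      rw [map_sub, augmentation_single, map_one, sub_self]
    have h := Ideal.mul_mem_left (augIdeal V ^ 2) (-(a : AddMonoidAlgebra ℤ V))
      (Ideal.pow_mem_pow hm 2)
    rw [augmentation_single, ha]
    convert h using 1
    linear_combination (a : AddMonoidAlgebra ℤ V) * hs

theorem two_pow_mul_mem (hV : ∀ v : V, v + v = 0) (n : ℕ) {x : AddMonoidAlgebra ℤ V}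
    (hx : x ∈ augIdeal V) : 2 ^ n * x ∈ augIdeal V ^ (n + 1) := by
  have h2 : Ideal.span {(2 : AddMonoidAlgebra ℤ V)} * augIdeal V ≤ augIdeal V ^ 2 := by
    rw [Ideal.span_singleton_mul_le_iff]
    intro y hy
    have h := two_mul_sub_mem hV y
    rwa [show augmentation V y = 0 from hy, Int.cast_zero, sub_zero] at h
  have key : ∀ k : ℕ, Ideal.span {(2 : AddMonoidAlgebra ℤ V)} ^ k * augIdeal V ≤
      augIdeal V ^ (k + 1) := by
    intro k
    induction k with
    | zero => simp
    | succ k ih =>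
      calc Ideal.span {(2 : AddMonoidAlgebra ℤ V)} ^ (k + 1) * augIdeal V
          = Ideal.span {2} * (Ideal.span {2} ^ k * augIdeal V) := by rw [pow_succ', mul_assoc]
        _ ≤ Ideal.span {2} * augIdeal V ^ (k + 1) := Ideal.mul_mono_right ih
        _ = (Ideal.span {2} * augIdeal V) * augIdeal V ^ k := by rw [pow_succ', mul_assoc]
        _ ≤ augIdeal V ^ 2 * augIdeal V ^ k := Ideal.mul_mono_left h2
        _ = augIdeal V ^ (k + 1 + 1) := by rw [← pow_add]; congr 1; omega
  exact key n (Ideal.mul_mem_mul (Ideal.pow_mem_pow (Ideal.mem_span_singleton_self _) n) hx)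

variable (V) in
/-- The map sending `k mod 2^n` to `x ↦ k • [x]`, from `ℤ/2^n` to `Hom(I, I/I^{n+1})`, where `I` is
the augmentation ideal; it is well defined because `2^n I ⊆ I^{n+1}`. -/
def modPowMul (hV : ∀ v : V, v + v = 0) (n : ℕ) :
    ZMod (2 ^ n) →+ (augIdeal V →+ augIdeal V ⧸ augPow V (n + 1)) :=
  ZMod.lift (2 ^ n) ⟨(zmultiplesHom _) (QuotientAddGroup.mk' (augPow V (n + 1))), by
    ext x
    rw [zmultiplesHom_apply, AddMonoidHom.zero_apply, AddMonoidHom.coe_smul, Pi.smul_apply,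
      ← map_zsmul, QuotientAddGroup.mk'_apply, QuotientAddGroup.eq_zero_iff, mem_augPow]
    have h := two_pow_mul_mem hV n x.2
    convert h using 1
    simp [zsmul_eq_mul]⟩

variable (V) in
/-- The map `ℤ₂ ⊗ I → I/I^{n+1}`, `z ⊗ x ↦ (z mod 2^n) • [x]`. -/
def tensorToQuot (hV : ∀ v : V, v + v = 0) (n : ℕ) :
    ℤ_[2] ⊗[ℤ] augIdeal V →+ augIdeal V ⧸ augPow V (n + 1) :=
  TensorProduct.liftAddHom
    ((modPowMul V hV n).comp (PadicInt.toZModPow (p := 2) n).toAddMonoidHom)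
    (fun r z x => by rw [map_zsmul, map_zsmul, AddMonoidHom.smul_apply])

theorem tensorToQuot_tmul (hV : ∀ v : V, v + v = 0) (n : ℕ) (z : ℤ_[2]) (x : augIdeal V)
    (k : ℤ) (hk : PadicInt.toZModPow n z = k) :
    tensorToQuot V hV n (z ⊗ₜ x) = k • (x : augIdeal V ⧸ augPow V (n + 1)) := by
  change modPowMul V hV n (PadicInt.toZModPow n z) x = _
  rw [hk, modPowMul, ZMod.lift_coe]
  rfl

theorem tensorToQuot_surjective (hV : ∀ v : V, v + v = 0) (n : ℕ) :
    Function.Surjective (tensorToQuot V hV n) := by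
  intro y
  obtain ⟨x, rfl⟩ := QuotientAddGroup.mk_surjective y
  exact ⟨1 ⊗ₜ x, by rw [tensorToQuot_tmul hV n 1 x 1 (by simp), one_zsmul]⟩

theorem tensorToQuot_natural {W : Type*} [AddCommGroup W] (hV : ∀ v : V, v + v = 0)
    (hW : ∀ w : W, w + w = 0) (n : ℕ) (g : V →+ W) :
    (tensorToQuot W hW n).comp (tensorMap g) = (quotMap n g).comp (tensorToQuot V hV n) := by
  ext t
  induction t using TensorProduct.induction_on with
  | zero => rw [map_zero, map_zero]
  | add s t hs ht => rw [map_add, map_add, hs, ht]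
  | tmul z x =>
    obtain ⟨k, hk⟩ := ZMod.intCast_surjective (PadicInt.toZModPow (p := 2) n z)
    change tensorToQuot W hW n (z ⊗ₜ augMap g x) = quotMap n g (tensorToQuot V hV n (z ⊗ₜ x))
    rw [tensorToQuot_tmul _ n z _ k hk.symm, tensorToQuot_tmul _ n z _ k hk.symm, map_zsmul]
    rfl

end Canonical

theorem add_self_eq_zero' (V : Vf.{u}) (v : V) : v + v = 0 := by
  rw [← two_smul F2 v, show (2 : F2) = 0 from rfl, zero_smul]

/-- The canonical surjection `P̄_{ℤ₂} → R^n_ℤ`, `z ⊗ x ↦ (z mod 2^n) • [x]`. -/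
def projZ2 (n : ℕ) : PbarZ2.{u} ⟶ R n where
  app V := AddCommGrpCat.ofHom (tensorToQuot V (add_self_eq_zero' V) n)
  naturality V W g := congrArg AddCommGrpCat.ofHom
    (tensorToQuot_natural (add_self_eq_zero' V) (add_self_eq_zero' W) n (addHom g))

theorem projZ2_isSurjection (n : ℕ) : IsSurjection (projZ2.{u} n) :=
  fun V => tensorToQuot_surjective (add_self_eq_zero' V) n

/-- On `P̄_ℤ` the canonical surjection is the projection onto the quotient. -/
theorem incl_projZ2 (n : ℕ) : incl.{u} ≫ projZ2 n = proj n := by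
  ext V x
  change tensorToQuot V (add_self_eq_zero' V) n (1 ⊗ₜ x) = QuotientAddGroup.mk x
  exact (tensorToQuot_tmul (add_self_eq_zero' V) n 1 x 1 (by simp)).trans (one_zsmul _)

end GroupRingFunctor

end

/-!
Write `I(V)` for the augmentation ideal of `ℤ[V]`. A linear form `φ` on `V` gives the ring
homomorphism `χ_φ : ℤ[V] → ℤ`, `[v] ↦ (-1)^{φ(v)}`, and these fit together into a natural pairing
`ℤ[V] × ℤ[V^♯] → ℤ`, symmetric in `V` and `V^♯`. Every character is congruent to the augmentation
modulo `2`, so it sends `I(V)^{n+1}` into `2^{n+1}ℤ`. Dividing by `2^{n+1}` therefore gives a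
pairing of `I(V)/I(V)^{n+1}` and `I(V^♯)/I(V^♯)^{n+1}` with values in `ℤ/2^∞` (`quotPairing`),
that is, a morphism `R^n_ℤ → D R^n_ℤ` (`toDual`).

The characters detect the filtration: if `2^k` divides `χ_φ(x)` for all `φ`, then `x` lies in
`I(V)^k` up to an integer multiple of `2^k`. This is proved by adjoining the vectors of `V` one at
a time (`exists_sub_mem_augIdeal_pow_of_mem_supportedOn`). Hence the pairing is nondegenerate. As
both quotients are finite of the same order and a finite group `A` has at most `|A|` homomorphisms
to `ℤ/2^∞`, it is perfect (`quotPairing_eval_bijective`), and `toDual` is an isomorphism.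

It remains to study the morphisms `P̄_{ℤ₂} → R^n_ℤ`. The functor `P̄_ℤ` is generated by
`[1] - [0] ∈ I(𝔽₂)`, the group `R^n_ℤ(𝔽₂)` is cyclic, generated by the class of that element, and
`ℤ₂ = ℤ + 2^n ℤ₂` where `2^n` kills `R^n_ℤ`. So every such morphism is an integer multiple
`c • π_n` of the canonical surjection (`exists_eq_zsmul_projZ2`). If it is surjective, so is
multiplication by `c` on the finite groups `R^n_ℤ(V)`, which is then an isomorphism; this gives the
factorization, and its uniqueness holds since `π_n` is an epimorphism.
-/

noncomputable section

namespace GroupRingFunctor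

/-! ### Characters and the augmentation filtration -/

section Characters

variable {V W : Type*} [AddCommGroup V] [Module F2 V] [AddCommGroup W] [Module F2 W]

/-- The sign character `a ↦ (-1)^a` of the additive group of `𝔽₂`, with integer values. -/
def signChar : Multiplicative F2 →* ℤ where
  toFun a := if a.toAdd = 0 then 1 else -1
  map_one' := by simp
  map_mul' := by decide

/-- The ring homomorphism `ℤ[V] → ℤ` with `[v] ↦ (-1)^{φ(v)}`. -/
def charHom (φ : V →ₗ[F2] F2) : AddMonoidAlgebra ℤ V →+* ℤ :=
  (AddMonoidAlgebra.lift ℤ ℤ V (signChar.comp φ.toAddMonoidHom.toMultiplicative) :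
    AddMonoidAlgebra ℤ V →ₐ[ℤ] ℤ).toRingHom

theorem charHom_single (φ : V →ₗ[F2] F2) (v : V) (a : ℤ) :
    charHom φ (AddMonoidAlgebra.single v a) = a * signChar (.ofAdd (φ v)) := by
  simp [charHom, AddMonoidAlgebra.lift_single]

theorem two_dvd_charHom_sub (φ : V →ₗ[F2] F2) (x : AddMonoidAlgebra ℤ V) :
    2 ∣ charHom φ x - augmentation V x := by
  induction x using AddMonoidAlgebra.induction_linear with
  | zero => simp
  | add x y hx hy =>
    rw [map_add, map_add, add_sub_add_comm]
    exact dvd_add hx hy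
  | single v a =>
    rw [charHom_single, augmentation_single, ← mul_sub_one]
    refine Dvd.dvd.mul_left ?_ a
    generalize φ v = b
    revert b
    decide

/-- Every character agrees with the augmentation modulo `2`, so it maps the augmentation ideal
into `2ℤ`. -/
theorem two_pow_dvd_charHom (φ : V →ₗ[F2] F2) (k : ℕ) {x : AddMonoidAlgebra ℤ V}
    (hx : x ∈ augIdeal V ^ k) : 2 ^ k ∣ charHom φ x := by
  have h1 : (augIdeal V).map (charHom φ) ≤ Ideal.span {2} :=
    Ideal.map_le_iff_le_comap.2 fun y hy => by
      have h := two_dvd_charHom_sub φ y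
      rw [show augmentation V y = 0 from hy, sub_zero] at h
      exact Ideal.mem_span_singleton.2 h
  have h2 := Ideal.mem_map_of_mem (charHom φ) hx
  rw [Ideal.map_pow] at h2
  have h3 := Ideal.pow_right_mono h1 k h2
  rwa [Ideal.span_singleton_pow, Ideal.mem_span_singleton] at h3

/-- The subgroup of `ℤ[V]` of elements supported on `U`, as the span of the `[u]` with `u ∈ U`. -/
def supportedOn (U : Submodule F2 V) : AddSubgroup (AddMonoidAlgebra ℤ V) :=
  AddSubgroup.closure ((fun u => AddMonoidAlgebra.single u 1) '' (U : Set V))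

theorem supportedOn_top : supportedOn (⊤ : Submodule F2 V) = ⊤ := by
  rw [eq_top_iff]
  intro x _
  induction x using AddMonoidAlgebra.induction_linear with
  | zero => exact zero_mem _
  | add x y hx hy => exact add_mem (hx trivial) (hy trivial)
  | single v a =>
    have h : (AddMonoidAlgebra.single v a : AddMonoidAlgebra ℤ V) =
        a • AddMonoidAlgebra.single v 1 := by
      rw [AddMonoidAlgebra.smul_single, smul_eq_mul, mul_one]
    rw [h]
    exact zsmul_mem (AddSubgroup.subset_closure (Set.mem_image_of_mem _ (Set.mem_univ v))) a

theorem exists_intCast_of_mem_supportedOn_bot {x : AddMonoidAlgebra ℤ V}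
    (hx : x ∈ supportedOn (⊥ : Submodule F2 V)) : ∃ a : ℤ, x = a := by
  rw [supportedOn, Submodule.bot_coe, Set.image_singleton, AddSubgroup.mem_closure_singleton] at hx
  obtain ⟨a, rfl⟩ := hx
  exact ⟨a, by rw [← AddMonoidAlgebra.one_def, zsmul_eq_mul, mul_one]⟩

theorem charHom_eq_of_eqOn {U : Submodule F2 V} {φ ψ : V →ₗ[F2] F2} (h : ∀ u ∈ U, φ u = ψ u)
    {x : AddMonoidAlgebra ℤ V} (hx : x ∈ supportedOn U) : charHom φ x = charHom ψ x := by
  induction hx using AddSubgroup.closure_induction with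
  | mem x hx =>
    obtain ⟨u, hu, rfl⟩ := hx
    rw [charHom_single, charHom_single, h u hu]
  | zero => rw [map_zero, map_zero]
  | add x y _ _ hx hy => rw [map_add, map_add, hx, hy]
  | neg x _ hx => rw [map_neg, map_neg, hx]

theorem exists_eq_add_mul_of_mem_supportedOn {U : Submodule F2 V} {v : V}
    {x : AddMonoidAlgebra ℤ V} (hx : x ∈ supportedOn (Submodule.span F2 {v} ⊔ U)) :
    ∃ y ∈ supportedOn U, ∃ z ∈ supportedOn U, x = y + z * (AddMonoidAlgebra.single v 1 - 1) := by
  induction hx using AddSubgroup.closure_induction with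
  | mem x hx =>
    obtain ⟨w, hw, rfl⟩ := hx
    obtain ⟨w', hw', u, hu, rfl⟩ := Submodule.mem_sup.1 hw
    obtain ⟨c, rfl⟩ := Submodule.mem_span_singleton.1 hw'
    have hu' : AddMonoidAlgebra.single u 1 ∈ supportedOn U :=
      AddSubgroup.subset_closure ⟨u, hu, rfl⟩
    obtain rfl | rfl := (by decide : ∀ c : F2, c = 0 ∨ c = 1) c
    · exact ⟨_, hu', 0, zero_mem _, by simp⟩
    · refine ⟨_, hu', _, hu', ?_⟩
      rw [mul_sub, AddMonoidAlgebra.single_mul_single, one_smul, add_comm u v]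
      simp
  | zero => exact ⟨0, zero_mem _, 0, zero_mem _, by simp⟩
  | add x x' _ _ hx hx' =>
    obtain ⟨y, hy, z, hz, rfl⟩ := hx
    obtain ⟨y', hy', z', hz', rfl⟩ := hx'
    exact ⟨_, add_mem hy hy', _, add_mem hz hz', by ring⟩
  | neg x _ hx =>
    obtain ⟨y, hy, z, hz, rfl⟩ := hx
    exact ⟨_, neg_mem hy, _, neg_mem hz, by ring⟩

theorem single_sub_one_mem {V : Type*} [AddCommGroup V] (v : V) :
    AddMonoidAlgebra.single v 1 - 1 ∈ augIdeal V := by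
  change augmentation V _ = 0
  rw [map_sub, augmentation_single, map_one, sub_self]

theorem add_self_eq_zero_of_module_F2 (v : V) : v + v = 0 := by
  rw [← two_smul F2 v, show (2 : F2) = 0 from rfl, zero_smul]

/-- The inductive step adjoins a vector `v` outside of the span `U` of the previous ones. Writing
`x = y + z([v] - [0])` with `y`, `z` supported on `U`, a linear form on `U` has two extensions to
`U + ⟨v⟩`; they take the values `χ(y)` and `χ(y) - 2χ(z)` on `x`, so that `χ(y)` is divisible
by `2^k` and `χ(z)` by `2^{k-1}`. -/
theorem exists_sub_mem_augIdeal_pow_of_mem_supportedOn {s : Set V} (hs : s.Finite) :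
    ∀ (k : ℕ) (x : AddMonoidAlgebra ℤ V), x ∈ supportedOn (Submodule.span F2 s) →
      (∀ φ : V →ₗ[F2] F2, 2 ^ k ∣ charHom φ x) →
      ∃ c : ℤ, x - 2 ^ k * (c : AddMonoidAlgebra ℤ V) ∈ augIdeal V ^ k := by
  induction s, hs using Set.Finite.induction_on with
  | empty =>
    intro k x hx hd
    rw [Submodule.span_empty] at hx
    obtain ⟨a, rfl⟩ := exists_intCast_of_mem_supportedOn_bot hx
    obtain ⟨c, hc⟩ := hd 0
    refine ⟨c, ?_⟩
    rw [map_intCast, Int.cast_id] at hc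
    rw [hc]
    simp
  | @insert v s _ _ ih =>
    intro k x hx hd
    rw [Submodule.span_insert] at hx
    by_cases hv : v ∈ Submodule.span F2 s
    · rw [sup_eq_right.2 ((Submodule.span_singleton_le_iff_mem _ _).2 hv)] at hx
      exact ih k x hx hd
    obtain ⟨y, hy, z, hz, rfl⟩ := exists_eq_add_mul_of_mem_supportedOn hx
    obtain ⟨ψ, hψv, hψ⟩ := Submodule.exists_le_ker_of_notMem hv
    replace hψv : ψ v = 1 := by
      generalize ψ v = b at hψv
      revert b; decide
    obtain _ | k := k
    · exact ⟨0, by simp⟩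
    have hval (φ : V →ₗ[F2] F2) : charHom φ (y + z * (AddMonoidAlgebra.single v 1 - 1)) =
        charHom φ y + charHom φ z * (signChar (.ofAdd (φ v)) - 1) := by
      rw [map_add, map_mul, map_sub, map_one, charHom_single, one_mul]
    -- The linear form `φ` can be given any value at `v` without changing it on the span of `s`.
    have hext (φ : V →ₗ[F2] F2) (c : F2) : ∃ φ' : V →ₗ[F2] F2, φ' v = c ∧
        ∀ u ∈ Submodule.span F2 s, φ' u = φ u := by
      refine ⟨φ + (c - φ v) • ψ, by simp [hψv], fun u hu => ?_⟩
      simp [show ψ u = 0 from hψ hu]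
    have hdy (φ : V →ₗ[F2] F2) : 2 ^ (k + 1) ∣ charHom φ y := by
      obtain ⟨φ', hφv, hφ⟩ := hext φ 0
      have h := hd φ'
      rw [hval, hφv, charHom_eq_of_eqOn hφ hy] at h
      simpa using h
    have hdz (φ : V →ₗ[F2] F2) : 2 ^ k ∣ charHom φ z := by
      obtain ⟨φ', hφv, hφ⟩ := hext φ 1
      have h := hd φ'
      rw [hval, hφv, charHom_eq_of_eqOn hφ hy, charHom_eq_of_eqOn hφ hz,
        (by decide : signChar (.ofAdd 1) - 1 = -2)] at h
      have h' := (Int.dvd_add_right (hdy φ)).1 h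
      rwa [mul_neg, dvd_neg, pow_succ, mul_dvd_mul_iff_right two_ne_zero] at h'
    obtain ⟨c, hc⟩ := ih (k + 1) y hy hdy
    obtain ⟨d, hdd⟩ := ih k z hz hdz
    have hb := single_sub_one_mem v
    have h1 := Ideal.mul_mem_mul hdd hb
    rw [← pow_succ] at h1
    have h2 := Ideal.mul_mem_left _ (d : AddMonoidAlgebra ℤ V)
      (two_pow_mul_mem add_self_eq_zero_of_module_F2 k hb)
    refine ⟨c, ?_⟩
    convert add_mem hc (add_mem h1 h2) using 1
    ring

/-- An element of the augmentation ideal on which all characters are divisible by `2^k` lies in the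
`k`-th power of that ideal: the pairing between `ℤ[V]` and `ℤ[V^♯]` detects the filtration. -/
theorem mem_augIdeal_pow_of_dvd_charHom [Finite V] (k : ℕ) {x : AddMonoidAlgebra ℤ V}
    (hx : x ∈ augIdeal V) (hd : ∀ φ : V →ₗ[F2] F2, 2 ^ k ∣ charHom φ x) :
    x ∈ augIdeal V ^ k := by
  obtain _ | k := k
  · simp
  obtain ⟨c, hc⟩ := exists_sub_mem_augIdeal_pow_of_mem_supportedOn (Set.finite_univ (α := V))
    (k + 1) x (by rw [Submodule.span_univ, supportedOn_top]; trivial) hd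
  -- The augmentation of `x - 2^{k+1} c` is `-2^{k+1} c`, which forces `c = 0`.
  have h0 : augmentation V _ = 0 := Ideal.pow_le_self k.succ_ne_zero hc
  rw [map_sub, show augmentation V x = 0 from hx, zero_sub, neg_eq_zero, map_mul, map_pow,
    map_ofNat, map_intCast, Int.cast_id, mul_eq_zero,
    or_iff_right (pow_ne_zero _ two_ne_zero)] at h0
  simpa [h0] using hc

end Characters

/-! ### Generators of the augmentation ideal -/

section Generators

variable {V : Type*} [AddCommGroup V]

/-- The element `[v] - [0]` of the augmentation ideal. -/
def augPoint (v : V) : augIdeal V :=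
  ⟨AddMonoidAlgebra.single v 1 - 1, single_sub_one_mem v⟩

theorem augPoint_zero : augPoint (0 : V) = 0 :=
  Subtype.ext (sub_self (1 : AddMonoidAlgebra ℤ V))

theorem augMap_augPoint {W : Type*} [AddCommGroup W] (g : V →+ W) (v : V) :
    augMap g (augPoint v) = augPoint (g v) :=
  Subtype.ext <| by
    change AddMonoidAlgebra.mapDomainRingHom ℤ g (AddMonoidAlgebra.single v 1 - 1) = _
    rw [map_sub, map_one]
    simp [augPoint]

theorem closure_range_augPoint : AddSubgroup.closure (Set.range (augPoint (V := V))) = ⊤ := by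
  have key (x : AddMonoidAlgebra ℤ V) :
      ∃ y ∈ AddSubgroup.closure (Set.range (augPoint (V := V))),
        (y : AddMonoidAlgebra ℤ V) = x - (augmentation V x : AddMonoidAlgebra ℤ V) := by
    induction x using AddMonoidAlgebra.induction_linear with
    | zero => exact ⟨0, zero_mem _, by simp⟩
    | add x x' hx hx' =>
      obtain ⟨y, hy, hyx⟩ := hx
      obtain ⟨y', hy', hyx'⟩ := hx'
      refine ⟨_, add_mem hy hy', ?_⟩
      rw [Submodule.coe_add, hyx, hyx', map_add, Int.cast_add]
      ring
    | single v a =>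
      refine ⟨_, zsmul_mem (AddSubgroup.subset_closure (Set.mem_range_self v)) a, ?_⟩
      rw [augmentation_single]
      change a • (AddMonoidAlgebra.single v 1 - 1 : AddMonoidAlgebra ℤ V) = _
      rw [smul_sub,
        AddMonoidAlgebra.smul_single, smul_eq_mul, mul_one, zsmul_eq_mul, mul_one]
  rw [eq_top_iff]
  intro x _
  obtain ⟨y, hy, hyx⟩ := key x
  rw [show augmentation V x = 0 from x.2, Int.cast_zero, sub_zero] at hyx
  rwa [← Subtype.ext hyx]

theorem augIdeal_hom_ext {A : Type*} [AddGroup A] {f g : augIdeal V →+ A}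
    (h : ∀ v, f (augPoint v) = g (augPoint v)) : f = g :=
  AddMonoidHom.eq_of_eqOn_dense closure_range_augPoint (by rintro _ ⟨v, rfl⟩; exact h v)

theorem card_quot_congr {W : Type*} [AddCommGroup W] (n : ℕ) (e : V ≃+ W) :
    Nat.card (augIdeal V ⧸ augPow V (n + 1)) = Nat.card (augIdeal W ⧸ augPow W (n + 1)) := by
  refine Nat.card_congr
    ⟨quotMap n e.toAddMonoidHom, quotMap n e.symm.toAddMonoidHom, fun x => ?_, fun x => ?_⟩
  · rw [← AddMonoidHom.comp_apply, ← quotMap_comp]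
    simp [quotMap_id]
  · rw [← AddMonoidHom.comp_apply, ← quotMap_comp]
    simp [quotMap_id]

theorem two_pow_nsmul_quot (hV : ∀ v : V, v + v = 0) (n : ℕ)
    (y : augIdeal V ⧸ augPow V (n + 1)) : 2 ^ n • y = 0 := by
  obtain ⟨x, rfl⟩ := QuotientAddGroup.mk_surjective y
  refine (QuotientAddGroup.eq_zero_iff _).2 ?_
  rw [mem_augPow]
  have h := two_pow_mul_mem hV n x.2
  convert h using 1
  simp [nsmul_eq_mul]

/-- Since `ℤ₂ = ℤ + 2^n ℤ₂` and `2^n` kills `I/I^{n+1}`, a homomorphism from `ℤ₂ ⊗ I` to this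
quotient is determined by its values on the elements `1 ⊗ ([v] - [0])`. -/
theorem eq_zsmul_tensorToQuot (hV : ∀ v : V, v + v = 0) (n : ℕ) (c : ℤ)
    (f : ℤ_[2] ⊗[ℤ] augIdeal V →+ augIdeal V ⧸ augPow V (n + 1))
    (hf : ∀ v, f (1 ⊗ₜ augPoint v) = c • (augPoint v : augIdeal V ⧸ augPow V (n + 1)))
    (t : ℤ_[2] ⊗[ℤ] augIdeal V) : f t = c • tensorToQuot V hV n t := by
  have hone : f.comp (TensorProduct.mk ℤ ℤ_[2] (augIdeal V) 1).toAddMonoidHom =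
      c • QuotientAddGroup.mk' (augPow V (n + 1)) := augIdeal_hom_ext hf
  induction t using TensorProduct.induction_on with
  | zero => rw [map_zero, map_zero, smul_zero]
  | add s t hs ht => rw [map_add, map_add, smul_add, hs, ht]
  | tmul z x =>
    obtain ⟨k, hk⟩ := ZMod.intCast_surjective (PadicInt.toZModPow (p := 2) n z)
    have hz : z - k ∈ RingHom.ker (PadicInt.toZModPow (p := 2) n) := by
      rw [RingHom.mem_ker, map_sub, map_intCast, hk, sub_self]
    rw [PadicInt.ker_toZModPow, Ideal.mem_span_singleton] at hz
    obtain ⟨w, hw⟩ := hz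
    have hzx : z ⊗ₜ[ℤ] x = k • ((1 : ℤ_[2]) ⊗ₜ[ℤ] x) + 2 ^ n • (w ⊗ₜ[ℤ] x) := by
      rw [TensorProduct.smul_tmul', ← Nat.cast_smul_eq_nsmul ℤ, TensorProduct.smul_tmul',
        ← TensorProduct.add_tmul, eq_add_of_sub_eq' hw]
      simp
    have h1 : f ((1 : ℤ_[2]) ⊗ₜ[ℤ] x) = c • (x : augIdeal V ⧸ augPow V (n + 1)) :=
      DFunLike.congr_fun hone x
    rw [tensorToQuot_tmul _ n z x k hk.symm, hzx, map_add, map_zsmul, map_nsmul,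
      two_pow_nsmul_quot hV, add_zero, h1, smul_comm]

end Generators

/-! ### Homomorphisms to the Prüfer group -/

section Prufer

/-- The class of `1/2^k` in `ℤ/2^∞`. -/
def invTwoPow (k : ℕ) : Prufer2 :=
  ⟨((1 / 2 ^ k : ℚ) : AddCircle (1 : ℚ)), k, by
    rw [← AddCircle.coe_nsmul, AddCircle.coe_eq_zero_iff]
    exact ⟨1, by simp⟩⟩

/-- The homomorphism `ℤ → ℤ/2^∞`, `m ↦ m/2^k`. -/
def divTwoPow (k : ℕ) : ℤ →+ Prufer2 := zmultiplesHom _ (invTwoPow k)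

theorem divTwoPow_eq_zero_iff {k : ℕ} {m : ℤ} : divTwoPow k m = 0 ↔ 2 ^ k ∣ m := by
  have h2 : (2 ^ k : ℚ) ≠ 0 := by positivity
  rw [divTwoPow, zmultiplesHom_apply, ← Subtype.coe_inj, AddSubgroup.coe_zsmul, invTwoPow,
    ← AddCircle.coe_zsmul, AddSubgroup.coe_zero, AddCircle.coe_eq_zero_iff]
  constructor
  · rintro ⟨c, hc⟩
    refine ⟨c, ?_⟩
    rw [zsmul_eq_mul, zsmul_eq_mul, mul_one, mul_one_div, eq_div_iff h2] at hc
    rw [mul_comm]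
    exact_mod_cast hc.symm
  · rintro ⟨c, rfl⟩
    refine ⟨c, ?_⟩
    rw [zsmul_eq_mul, zsmul_eq_mul, mul_one]
    push_cast
    field_simp

/-- The embedding of `ℤ/2^∞` into the circle, `x ↦ exp(2πix)`. -/
def pruferToCircle : Multiplicative Prufer2 →* Circle where
  toFun x := AddCircle.toCircle (T := 1)
    (QuotientAddGroup.map (AddSubgroup.zmultiples (1 : ℚ)) (AddSubgroup.zmultiples (1 : ℝ))
      (Rat.castHom ℝ : ℚ →+ ℝ) (by simp [AddSubgroup.zmultiples_le]) (x.toAdd : AddCircle (1 : ℚ)))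
  map_one' := by simp
  map_mul' x y := by
    rw [toAdd_mul, AddSubgroup.coe_add, map_add, AddCircle.toCircle_add]

theorem pruferToCircle_injective : Function.Injective pruferToCircle := by
  rw [injective_iff_map_eq_one]
  intro x hx
  have h0 := AddCircle.injective_toCircle one_ne_zero (hx.trans AddCircle.toCircle_zero.symm)
  have hx' : ((Multiplicative.toAdd x : Prufer2) : AddCircle (1 : ℚ)) = 0 := by
    generalize ((Multiplicative.toAdd x : Prufer2) : AddCircle (1 : ℚ)) = y at h0
    obtain ⟨q, rfl⟩ := QuotientAddGroup.mk_surjective y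
    replace h0 : ((q : ℝ) : AddCircle (1 : ℝ)) = 0 := h0
    obtain ⟨c, hc⟩ := AddCircle.coe_eq_zero_iff _ |>.1 h0
    refine (AddCircle.coe_eq_zero_iff _).2 ⟨c, ?_⟩
    rw [zsmul_eq_mul, mul_one] at hc ⊢
    exact_mod_cast hc
  exact Subtype.ext hx'

/-- A homomorphism to `ℤ/2^∞` as a complex character. -/
def pruferHomToAddChar {A : Type*} [AddCommGroup A] (f : A →+ Prufer2) : AddChar A ℂ :=
  AddChar.toMonoidHomEquiv.symm
    (Circle.coeHom.comp (pruferToCircle.comp f.toMultiplicative))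

theorem pruferHomToAddChar_injective {A : Type*} [AddCommGroup A] :
    Function.Injective (pruferHomToAddChar (A := A)) := by
  intro f g h
  ext1 a
  have h1 := DFunLike.congr_fun h a
  exact Multiplicative.ofAdd.injective (pruferToCircle_injective (Circle.coe_injective h1))

theorem finite_pruferHom (A : Type*) [AddCommGroup A] [Finite A] : Finite (A →+ Prufer2) :=
  .of_injective _ pruferHomToAddChar_injective

theorem card_pruferHom_le (A : Type*) [AddCommGroup A] [Finite A] :
    Nat.card (A →+ Prufer2) ≤ Nat.card A := by
  have := Fintype.ofFinite A
  refine (Nat.card_le_card_of_injective _ pruferHomToAddChar_injective).trans_eq ?_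
  rw [Nat.card_eq_fintype_card, Nat.card_eq_fintype_card, AddChar.card_eq]

end Prufer

/-! ### The perfect pairing -/

section Pairing

variable {V W : Type*} [AddCommGroup V] [Module F2 V] [AddCommGroup W] [Module F2 W]

/-- The pairing `ℤ[V] × ℤ[W] → ℤ` with `([v], [w]) ↦ (-1)^{μ(v, w)}`. -/
def groupRingPairing (μ : V →ₗ[F2] W →ₗ[F2] F2) :
    AddMonoidAlgebra ℤ V →+ AddMonoidAlgebra ℤ W →+ ℤ :=
  (Finsupp.liftAddHom fun v => zmultiplesHom _ (charHom (μ v)).toAddMonoidHom).comp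
    AddMonoidAlgebra.coeffAddEquiv.toAddMonoidHom

theorem groupRingPairing_single (μ : V →ₗ[F2] W →ₗ[F2] F2) (v : V) (a : ℤ)
    (y : AddMonoidAlgebra ℤ W) :
    groupRingPairing μ (AddMonoidAlgebra.single v a) y = a * charHom (μ v) y := by
  change (Finsupp.liftAddHom fun v => zmultiplesHom _ (charHom (μ v)).toAddMonoidHom)
    (Finsupp.single v a) y = _
  rw [Finsupp.liftAddHom_apply_single]
  simp

theorem groupRingPairing_flip (μ : V →ₗ[F2] W →ₗ[F2] F2) (x : AddMonoidAlgebra ℤ V)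
    (y : AddMonoidAlgebra ℤ W) : groupRingPairing μ x y = groupRingPairing μ.flip y x := by
  induction x using AddMonoidAlgebra.induction_linear with
  | zero => simp
  | add x x' hx hx' => rw [map_add, map_add, AddMonoidHom.add_apply, hx, hx']
  | single v a =>
    induction y using AddMonoidAlgebra.induction_linear with
    | zero => simp
    | add y y' hy hy' => rw [map_add, map_add, AddMonoidHom.add_apply, hy, hy']
    | single w b =>
      rw [groupRingPairing_single, groupRingPairing_single, charHom_single, charHom_single,
        LinearMap.flip_apply]
      ring

theorem two_pow_dvd_groupRingPairing_right (μ : V →ₗ[F2] W →ₗ[F2] F2) (k : ℕ)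
    (x : AddMonoidAlgebra ℤ V) {y : AddMonoidAlgebra ℤ W} (hy : y ∈ augIdeal W ^ k) :
    2 ^ k ∣ groupRingPairing μ x y := by
  induction x using AddMonoidAlgebra.induction_linear with
  | zero => simp
  | add x x' hx hx' =>
    rw [map_add, AddMonoidHom.add_apply]
    exact dvd_add hx hx'
  | single v a =>
    rw [groupRingPairing_single]
    exact (two_pow_dvd_charHom _ k hy).mul_left a

theorem two_pow_dvd_groupRingPairing_left (μ : V →ₗ[F2] W →ₗ[F2] F2) (k : ℕ)
    {x : AddMonoidAlgebra ℤ V} (hx : x ∈ augIdeal V ^ k) (y : AddMonoidAlgebra ℤ W) :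
    2 ^ k ∣ groupRingPairing μ x y := by
  rw [groupRingPairing_flip]
  exact two_pow_dvd_groupRingPairing_right _ k y hx

/-- The pairing `I(V)/I(V)^{n+1} × I(W)/I(W)^{n+1} → ℤ/2^∞` of the quotients of the augmentation
ideals induced by `μ`: the pairing of the group rings divided by `2^{n+1}`. -/
def quotPairing (n : ℕ) (μ : V →ₗ[F2] W →ₗ[F2] F2) :
    augIdeal V ⧸ augPow V (n + 1) →+ augIdeal W ⧸ augPow W (n + 1) →+ Prufer2 :=
  QuotientAddGroup.lift _
    (AddMonoidHom.mk'
      (fun x => QuotientAddGroup.lift _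
        (((divTwoPow (n + 1)).comp (groupRingPairing μ x)).comp
          (augIdeal W).subtype.toAddMonoidHom)
        fun _ hy => divTwoPow_eq_zero_iff.2
          (two_pow_dvd_groupRingPairing_right μ (n + 1) x (mem_augPow.1 hy)))
      fun x x' => by
        ext y : 2
        exact (congrArg (divTwoPow (n + 1)) (congrArg (fun f => f (y : AddMonoidAlgebra ℤ W))
          (map_add (groupRingPairing μ) (x : AddMonoidAlgebra ℤ V) x'))).trans (map_add _ _ _))
    fun x hx => by
      ext y : 2
      exact divTwoPow_eq_zero_iff.2
        (two_pow_dvd_groupRingPairing_left μ (n + 1) (mem_augPow.1 hx) y)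

theorem quotPairing_mk (n : ℕ) (μ : V →ₗ[F2] W →ₗ[F2] F2) (x : augIdeal V) (y : augIdeal W) :
    quotPairing n μ (x : augIdeal V ⧸ augPow V (n + 1)) (y : augIdeal W ⧸ augPow W (n + 1)) =
      divTwoPow (n + 1) (groupRingPairing μ x y) := rfl

theorem quotPairing_natural {V' W' : Type*} [AddCommGroup V'] [Module F2 V'] [AddCommGroup W']
    [Module F2 W'] (n : ℕ) {μ : V →ₗ[F2] W →ₗ[F2] F2} {μ' : V' →ₗ[F2] W' →ₗ[F2] F2}
    (g : V →+ V') (h : W' →+ W) (hgh : ∀ v w, μ' (g v) w = μ v (h w))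
    (x : augIdeal V ⧸ augPow V (n + 1)) (y : augIdeal W' ⧸ augPow W' (n + 1)) :
    quotPairing n μ' (quotMap n g x) y = quotPairing n μ x (quotMap n h y) := by
  obtain ⟨x, rfl⟩ := QuotientAddGroup.mk_surjective x
  obtain ⟨y, rfl⟩ := QuotientAddGroup.mk_surjective y
  refine congrArg (divTwoPow (n + 1)) ?_
  change groupRingPairing μ' (AddMonoidAlgebra.mapDomainRingHom ℤ g x) y =
    groupRingPairing μ x (AddMonoidAlgebra.mapDomainRingHom ℤ h y)
  generalize (x : AddMonoidAlgebra ℤ V) = x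
  generalize (y : AddMonoidAlgebra ℤ W') = y
  induction x using AddMonoidAlgebra.induction_linear with
  | zero => simp
  | add x x' hx hx' => simp only [map_add, AddMonoidHom.add_apply, hx, hx']
  | single v a =>
    induction y using AddMonoidAlgebra.induction_linear with
    | zero => simp
    | add y y' hy hy' => simp only [map_add, hy, hy']
    | single w b =>
      simp [groupRingPairing_single, charHom_single, hgh]

/-- A homomorphism `I/I^{n+1} → (V^♯ → ℤ/2^{n+1})` collecting the values of all characters shows
that `I/I^{n+1}` is finite. -/
theorem finite_quot [Finite V] (n : ℕ) : Finite (augIdeal V ⧸ augPow V (n + 1)) := by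
  have : Finite (V →ₗ[F2] F2) := .of_injective _ DFunLike.coe_injective
  let F : augIdeal V →+ ((V →ₗ[F2] F2) → ZMod (2 ^ (n + 1))) :=
    AddMonoidHom.mk' (fun x φ => ((charHom φ x : ℤ) : ZMod (2 ^ (n + 1)))) fun x y => by
      ext φ
      simp
  have hF : F.ker ≤ augPow V (n + 1) := fun x hx =>
    mem_augIdeal_pow_of_dvd_charHom (n + 1) x.2 fun φ => by
      have h := congrFun (AddMonoidHom.mem_ker.1 hx) φ
      exact_mod_cast (ZMod.intCast_zmod_eq_zero_iff_dvd _ _).1 h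
  have : Finite (augIdeal V ⧸ F.ker) :=
    .of_injective _ (QuotientAddGroup.kerLift_injective F)
  refine Finite.of_surjective
    (QuotientAddGroup.map F.ker (augPow V (n + 1)) (AddMonoidHom.id _) hF) fun y => ?_
  obtain ⟨x, rfl⟩ := QuotientAddGroup.mk_surjective y
  exact ⟨(x : augIdeal V ⧸ F.ker), rfl⟩

/-- If every linear form on `V` is some `μ(·, w)`, then pairing `x ∈ I(V)` with `[w] - [0]` gives
every character value of `x`, as the trivial character vanishes on `I(V)`. -/
theorem quotPairing_injective [Finite V] (n : ℕ) {μ : V →ₗ[F2] W →ₗ[F2] F2}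
    (hμ : Function.Surjective μ.flip) : Function.Injective (quotPairing n μ) := by
  rw [injective_iff_map_eq_zero]
  intro x hx
  obtain ⟨x, rfl⟩ := QuotientAddGroup.mk_surjective x
  rw [QuotientAddGroup.eq_zero_iff]
  refine mem_augIdeal_pow_of_dvd_charHom (n + 1) x.2 fun φ => ?_
  obtain ⟨w, rfl⟩ := hμ φ
  have h := DFunLike.congr_fun hx (augPoint w : augIdeal W ⧸ augPow W (n + 1))
  rw [quotPairing_mk, AddMonoidHom.zero_apply, divTwoPow_eq_zero_iff, groupRingPairing_flip,
    augPoint, map_sub, AddMonoidHom.sub_apply, AddMonoidAlgebra.one_def, groupRingPairing_single,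
    groupRingPairing_single, one_mul, one_mul] at h
  have h0 : charHom (μ.flip 0) x = 0 := by
    have hx0 : augmentation V x = 0 := x.2
    rw [← hx0, map_zero]
    generalize (x : AddMonoidAlgebra ℤ V) = x
    induction x using AddMonoidAlgebra.induction_linear with
    | zero => simp
    | add x y hx hy => rw [map_add, map_add, hx, hy]
    | single v a => rw [charHom_single, augmentation_single, LinearMap.zero_apply, ofAdd_zero,
        map_one, mul_one]
  rwa [h0, sub_zero] at h

/-- The pairing between `V` and `V^♯` is nondegenerate, and the two quotients are finite of the
same order, so that it is perfect. -/
theorem quotPairing_eval_bijective [Module.Finite F2 V] (n : ℕ) :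
    Function.Bijective (quotPairing n (Module.Dual.eval F2 V)) := by
  have : Finite V := Module.finite_of_finite F2
  have : Finite (Module.Dual F2 V) := Module.finite_of_finite F2
  have := finite_quot (V := V) n
  have := finite_quot (V := Module.Dual F2 V) n
  have := finite_pruferHom (augIdeal (Module.Dual F2 V) ⧸ augPow (Module.Dual F2 V) (n + 1))
  have := Fintype.ofFinite (augIdeal V ⧸ augPow V (n + 1))
  have := Fintype.ofFinite
    (augIdeal (Module.Dual F2 V) ⧸ augPow (Module.Dual F2 V) (n + 1) →+ Prufer2)
  have hinj : Function.Injective (quotPairing n (Module.Dual.eval F2 V)) :=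
    quotPairing_injective n fun φ => ⟨φ, rfl⟩
  have e : V ≃ₗ[F2] Module.Dual F2 V := (Module.Free.chooseBasis F2 V).toDualEquiv
  refine (Nat.bijective_iff_injective_and_card _).2 ⟨hinj, ?_⟩
  refine (Nat.card_le_card_of_injective _ hinj).antisymm ?_
  rw [card_quot_congr n e.toAddEquiv]
  exact card_pruferHom_le _

end Pairing

/-! ### Morphisms of functors -/

/-- The morphism `R^n_ℤ → D R^n_ℤ` adjoint to the pairing of `I(V)/I(V)^{n+1}` with
`I(V^♯)/I(V^♯)^{n+1}`. -/
def toDual (n : ℕ) : R.{u} n ⟶ D.obj (op (R n)) where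
  app V := AddCommGrpCat.ofHom (quotPairing n (Module.Dual.eval F2 V))
  naturality V W g := by
    ext x : 2
    refine AddMonoidHom.ext fun y => ?_
    exact quotPairing_natural n (μ := Module.Dual.eval F2 V) (μ' := Module.Dual.eval F2 W)
      (addHom g) (Module.Dual.transpose (R := F2) g.hom.hom).toAddMonoidHom (fun _ _ => rfl) x y

theorem isIso_of_bijective {F G : FA.{u}} (f : F ⟶ G)
    (h : ∀ V : Vf.{u}, Function.Bijective (f.app V)) : IsIso f := by
  have (V : Vf.{u}) : IsIso (f.app V) := (ConcreteCategory.isIso_iff_bijective _).2 (h V)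
  exact NatIso.isIso_of_isIso_app f

theorem isIso_toDual (n : ℕ) : IsIso (toDual.{u} n) :=
  isIso_of_bijective _ fun V => quotPairing_eval_bijective (V := V) n

/-- The line `𝔽₂` in the universe `u`. -/
abbrev line : Vf.{u} := FGModuleCat.of F2 (ULift.{u} F2)

/-- The linear map `𝔽₂ → V` with `1 ↦ v`. -/
def lineTo (V : Vf.{u}) (v : V) : line.{u} ⟶ V :=
  FGModuleCat.ofHom ((LinearMap.toSpanSingleton F2 V v).comp ULift.moduleEquiv.toLinearMap)

theorem exists_zsmul_augPoint_line (x : augIdeal line.{u}) :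
    ∃ c : ℤ, x = c • augPoint (ULift.up 1 : line.{u}) := by
  have hx : x ∈ AddSubgroup.closure (Set.range (augPoint (V := line.{u}))) := by
    rw [closure_range_augPoint]
    trivial
  have hle : AddSubgroup.closure (Set.range (augPoint (V := line.{u}))) ≤
      AddSubgroup.zmultiples (augPoint (ULift.up 1 : line.{u})) := by
    rw [AddSubgroup.closure_le]
    rintro _ ⟨⟨a⟩, rfl⟩
    obtain rfl | rfl := (by decide : ∀ c : F2, c = 0 ∨ c = 1) a
    · rw [show (ULift.up 0 : line.{u}) = 0 from rfl, augPoint_zero]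
      exact zero_mem _
    · exact AddSubgroup.mem_zmultiples _
  obtain ⟨c, hc⟩ := AddSubgroup.mem_zmultiples_iff.1 (hle hx)
  exact ⟨c, hc.symm⟩

/-- `P̄_ℤ` is generated by the element `[1] - [0]` of its value at `𝔽₂`, whose images generate the
cyclic group `R^n_ℤ(𝔽₂)`, so that a morphism `P̄_{ℤ₂} → R^n_ℤ` is determined by an integer. -/
theorem exists_eq_zsmul_projZ2 (n : ℕ) (h : PbarZ2.{u} ⟶ R n) : ∃ c : ℤ, h = c • projZ2 n := by
  obtain ⟨x₀, hx₀⟩ := QuotientAddGroup.mk_surjective (s := augPow line.{u} (n + 1))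
    (h.app line (1 ⊗ₜ augPoint (ULift.up 1 : line.{u})))
  obtain ⟨c, rfl⟩ := exists_zsmul_augPoint_line x₀
  refine ⟨c, ?_⟩
  ext V t
  rw [NatTrans.app_zsmul]
  refine eq_zsmul_tensorToQuot (add_self_eq_zero' V) n c (h.app V).hom (fun v => ?_) t
  have hv : augMap (addHom (lineTo V v)) (augPoint (ULift.up 1 : line.{u})) = augPoint v := by
    rw [augMap_augPoint]
    congr 1
    exact one_smul F2 v
  have hnat := ConcreteCategory.congr_hom (h.naturality (lineTo V v))
    (1 ⊗ₜ augPoint (ULift.up 1 : line.{u}))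
  change (h.app V).hom ((1 : ℤ_[2]) ⊗ₜ[ℤ] augMap (addHom (lineTo V v)) (augPoint (ULift.up 1))) =
    quotMap n (addHom (lineTo V v)) (h.app line (1 ⊗ₜ augPoint (ULift.up 1 : line.{u}))) at hnat
  rw [← hx₀, hv] at hnat
  refine hnat.trans ?_
  change QuotientAddGroup.mk (augMap (addHom (lineTo V v)) (c • augPoint (ULift.up 1))) = _
  rw [map_zsmul, hv]
  rfl

theorem isSurjection_comp_iso {F G H : FA.{u}} (f : F ⟶ G) (e : G ⟶ H) [IsIso e] :
    IsSurjection (f ≫ e) ↔ IsSurjection f := by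
  refine forall_congr' fun V => ?_
  have he : Function.Bijective (e.app V) := (ConcreteCategory.isIso_iff_bijective _).1 inferInstance
  rw [NatTrans.comp_app, ConcreteCategory.coe_comp]
  exact ⟨fun h => h.of_comp_left he.1, fun h => he.2.comp h⟩

theorem IsSurjection.epi {F G : FA.{u}} {f : F ⟶ G} (hf : IsSurjection f) : Epi f := by
  have (V : Vf.{u}) : Epi (f.app V) := (AddCommGrpCat.epi_iff_surjective _).2 (hf V)
  exact NatTrans.epi_of_epi_app f

/-- A surjective endomorphism of `R^n_ℤ` is an isomorphism, since the values are finite. -/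
theorem isIso_of_isSurjection (n : ℕ) {e : R.{u} n ⟶ R n} (he : IsSurjection e) : IsIso e := by
  refine isIso_of_bijective e fun V => ?_
  have : Finite V := Module.finite_of_finite F2
  have : Finite ((R n).obj V) := finite_quot (V := V) n
  exact Finite.surjective_iff_bijective.1 (he V)

end GroupRingFunctor
end

theorem mainTheorem5 (n : ℕ) (hn : 0 < n) :
    Nonempty (GroupRingFunctor.R.{u} n ≅
      GroupRingFunctor.D.obj (op (GroupRingFunctor.R.{u} n))) ∧
    (∃ f : GroupRingFunctor.PbarZ2.{u} ⟶
        GroupRingFunctor.D.obj (op (GroupRingFunctor.R.{u} n)),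
      GroupRingFunctor.IsSurjection f) ∧
    ∀ f : GroupRingFunctor.PbarZ2.{u} ⟶
        GroupRingFunctor.D.obj (op (GroupRingFunctor.R.{u} n)),
      GroupRingFunctor.IsSurjection f →
      ∃! e : GroupRingFunctor.R.{u} n ≅
          GroupRingFunctor.D.obj (op (GroupRingFunctor.R.{u} n)),
        GroupRingFunctor.projZ2 n ≫ e.hom = f := by
  have := GroupRingFunctor.isIso_toDual.{u} n
  have hpi := GroupRingFunctor.projZ2_isSurjection.{u} n
  have := hpi.epi
  let β := asIso (GroupRingFunctor.toDual.{u} n)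
  refine ⟨⟨β⟩, ⟨_, (GroupRingFunctor.isSurjection_comp_iso _ β.hom).2 hpi⟩, fun f hf => ?_⟩
  -- Through the duality `β`, the morphism `f` becomes a multiple of the canonical surjection.
  obtain ⟨c, hc⟩ := GroupRingFunctor.exists_eq_zsmul_projZ2 n (f ≫ β.inv)
  have hc' : GroupRingFunctor.projZ2.{u} n ≫ (c • 𝟙 _) = f ≫ β.inv := by
    rw [hc, Preadditive.comp_zsmul, Category.comp_id]
  have hsurj : GroupRingFunctor.IsSurjection (c • 𝟙 (GroupRingFunctor.R.{u} n)) := fun V => by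
    have h := (GroupRingFunctor.isSurjection_comp_iso f β.inv).2 hf V
    rw [← hc', NatTrans.comp_app, ConcreteCategory.coe_comp] at h
    exact h.of_comp
  have := GroupRingFunctor.isIso_of_isSurjection n hsurj
  refine ⟨asIso (c • 𝟙 _) ≪≫ β, ?_, fun e he => ?_⟩
  · change GroupRingFunctor.projZ2 n ≫ (c • 𝟙 _) ≫ β.hom = f
    rw [← Category.assoc, hc', Category.assoc, β.inv_hom_id, Category.comp_id]
  · ext1
    rw [← cancel_epi (GroupRingFunctor.projZ2.{u} n), he]
    change f = GroupRingFunctor.projZ2 n ≫ (c • 𝟙 _) ≫ β.hom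
    rw [← Category.assoc, hc', Category.assoc, β.inv_hom_id, Category.comp_id]
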